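/- Let $R$ be a reduced irreducible (crystallographic) finite root system in a real vector space $V$, let $R^\times=R\setminus\{0\}$ be its set of nonzero roots, let $w_\alpha\in GL(V)$ denote the reflection based on $\alpha\in R^\times$, and let $\mathcal W=\langle w_\alpha\mid\alpha\in R^\times\rangle$ be the Weyl group. For $\mathcal P\subseteq R^\times$ put $\mathcal W_{\mathcal P}:=\langle w_\alpha\mid \alpha\in\mathcal P\rangle$ and $\mathcal W_{\mathcal P}\mathcal P:=\{w(\alpha)\mid w\in\mathcal W_{\mathcal P},\ \alpha\in\mathcal P\}$. Define the following classes of subsets of $R^\times$: * $\mathcal M_r$ (reflectable bases): all $\mathcal P\subseteq R^\times$ such that $\mathcal W_{\mathcal P}\mathcal P=R^\times$ and $\mathcal W_{\mathcal P'}\mathcal P'\neq R^\times$ for every proper subset $\mathcal P'\subsetneq\mathcal P$; * $\mathcal M_m$ ($S$-minimal sets): all $\mathcal P\subseteq R^\times$ such that $\mathcal W_{\mathcal P}=\mathcal W$ and $\mathcal W_{\mathcal P'}\neq\mathcal W$ for every proper subset $\mathcal P'\subsetneq\mathcal P$; * $\mathcal M_c$ ($c$-minimal sets): all $\mathcal P\subseteq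 R^\times$ such that $\mathcal W_{\mathcal P}=\mathcal W$ and $|\mathcal P|=c$, where $c$ is the least number of reflections $w_\alpha$, $\alpha\in R^\times$, generating $\mathcal W$. Then $\mathcal M_c=\mathcal M_m=\mathcal M_r$. -/

import Mathlib

/-! Classes of generating sets attached to a root system.  The roots are indexed by `ι` through the
embedding `P.root : ι ↪ V`, so a set of nonzero roots is given by a set `s : Set ι` of indices. -/

namespace RootGen

variable {ι V N : Type*} [AddCommGroup V] [Module ℝ V] [AddCommGroup N] [Module ℝ N]

/-- The Weyl group, as the subgroup of `GL(V)` generated by the reflections in all roots. -/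
def weyl (P : RootPairing ι ℝ V N) : Subgroup (V ≃ₗ[ℝ] V) :=
  Subgroup.closure (Set.range P.reflection)

/-- The subgroup of `GL(V)` generated by the reflections in the roots indexed by `s`. -/
def weylOf (P : RootPairing ι ℝ V N) (s : Set ι) : Subgroup (V ≃ₗ[ℝ] V) :=
  Subgroup.closure (P.reflection '' s)

/-- `s` is a reflectable set: the images of the roots in `s` under the group generated by the
reflections in the roots of `s` are exactly all the nonzero roots. -/
def IsReflectableSet (P : RootPairing ι ℝ V N) (s : Set ι) : Prop :=
  {v : V | ∃ w ∈ weylOf P s, ∃ i ∈ s, v = w (P.root i)} = Set.range P.root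

/-- The class of reflectable bases: reflectable sets no proper subset of which is reflectable. -/
def reflectableBases (P : RootPairing ι ℝ V N) : Set (Set ι) :=
  {s | IsReflectableSet P s ∧ ∀ t, t ⊂ s → ¬ IsReflectableSet P t}

/-- The class of sets of roots that are minimal, with respect to inclusion, among those whose
reflections generate the Weyl group. -/
def sMinimalSets (P : RootPairing ι ℝ V N) : Set (Set ι) :=
  {s | weylOf P s = weyl P ∧ ∀ t, t ⊂ s → weylOf P t ≠ weyl P}

/-- The least number of reflections generating the Weyl group. -/
noncomputable def minReflections (P : RootPairing ι ℝ V N) : ℕ∞ :=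
  sInf {n | ∃ T : Set (V ≃ₗ[ℝ] V),
    T ⊆ Set.range P.reflection ∧ Subgroup.closure T = weyl P ∧ T.encard = n}

/-- The class of sets of roots of that least cardinality whose reflections generate the Weyl
group. -/
def cMinimalSets (P : RootPairing ι ℝ V N) : Set (Set ι) :=
  {s | s.encard = minReflections P ∧ weylOf P s = weyl P}

end RootGen

open Submodule

namespace RootGen

variable {ι V N : Type*} [AddCommGroup V] [Module ℝ V] [AddCommGroup N] [Module ℝ N]

/-! The hinge is that three properties of a set `s` of roots are equivalent: its reflections
generate the Weyl group, it is reflectable, and it generates both the root lattice and the coroot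
lattice. The equality of $\mathcal M_m$ and $\mathcal M_r$ is then formal.

If the reflections generate, each `P.reflection i` moves a weight by an integral combination of
roots of `s`; a weight with value 1 on the coroot of `i` makes that displacement minus the root
itself. Duality gives the coroots. Conversely, a short root that is a sum of roots of `s` lies in
the orbits of `s` (`IsShort.mem_of_list_sum_eq`), and every root is short either in `P` or in
`P.flip`.

For $\mathcal M_c$, a generating set spans `V`, so it has at least `finrank ℝ V` elements, and
minimal generating sets attain this bound. Indeed a linearly dependent set contains a circuit of
roots; a primitive circuit has a coefficient ±1 (`exists_isUnit_of_circuit`), and one root can be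
chosen with unit coefficient in both the root and the coroot circuit (`exists_unit_relations`).
Removing it preserves both lattices. -/

/-! ### Action of the Weyl group on roots, and reflectable sets. -/

lemma reflection_mem_weylOf (P : RootPairing ι ℝ V N) {s : Set ι} {i : ι} (hi : i ∈ s) :
    P.reflection i ∈ weylOf P s :=
  Subgroup.subset_closure ⟨i, hi, rfl⟩

lemma weylOf_le_weyl (P : RootPairing ι ℝ V N) (s : Set ι) : weylOf P s ≤ weyl P :=
  Subgroup.closure_mono (Set.image_subset_range _ _)

lemma weylOf_univ (P : RootPairing ι ℝ V N) : weylOf P Set.univ = weyl P := by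
  simp [weylOf, weyl]

lemma weylOf_eq_weyl_iff (P : RootPairing ι ℝ V N) (s : Set ι) :
    weylOf P s = weyl P ↔ ∀ i, P.reflection i ∈ weylOf P s := by
  constructor
  · intro h i
    rw [h]
    exact Subgroup.subset_closure ⟨i, rfl⟩
  · intro h
    refine le_antisymm (weylOf_le_weyl P s) ((Subgroup.closure_le _).2 ?_)
    rintro _ ⟨i, rfl⟩
    exact h i

lemma pairing_eq_intCast (P : RootPairing ι ℝ V N) [P.IsCrystallographic] (i j : ι) :
    P.pairing i j = (P.pairingIn ℤ i j : ℝ) := by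
  rw [← P.algebraMap_pairingIn ℤ]
  simp

/-- The group generated by the reflections acts on the roots. -/
lemma exists_root_eq_of_mem_weyl (P : RootPairing ι ℝ V N) {w : V ≃ₗ[ℝ] V} (hw : w ∈ weyl P) :
    (∀ i, ∃ j, P.root j = w (P.root i)) ∧ ∀ i, ∃ j, P.root j = w⁻¹ (P.root i) := by
  induction hw using Subgroup.closure_induction with
  | mem w hw =>
    obtain ⟨k, rfl⟩ := hw
    exact ⟨fun i ↦ ⟨_, P.root_reflectionPerm k i⟩, fun i ↦ ⟨_, P.root_reflectionPerm k i⟩⟩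
  | one => exact ⟨fun i ↦ ⟨i, rfl⟩, fun i ↦ ⟨i, by simp⟩⟩
  | mul x y _ _ hx hy =>
    constructor
    · intro i
      obtain ⟨j, hj⟩ := hy.1 i
      obtain ⟨k, hk⟩ := hx.1 j
      exact ⟨k, by rw [hk, hj]; rfl⟩
    · intro i
      obtain ⟨j, hj⟩ := hx.2 i
      obtain ⟨k, hk⟩ := hy.2 j
      exact ⟨k, by rw [hk, hj, mul_inv_rev]; rfl⟩
  | inv x _ hx => exact ⟨hx.2, by simpa using hx.1⟩

/-- The reflection in the image of a root is a conjugate of the reflection in that root. -/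
lemma reflection_eq_conj_of_mem_weyl (P : RootPairing ι ℝ V N) {w : V ≃ₗ[ℝ] V}
    (hw : w ∈ weyl P) :
    ∀ i j, P.root j = w (P.root i) → P.reflection j = w * P.reflection i * w⁻¹ := by
  induction hw using Subgroup.closure_induction with
  | mem w hw =>
    obtain ⟨k, rfl⟩ := hw
    intro i j h
    have : j = P.reflectionPerm k i := P.root.injective (by rw [h, P.root_reflectionPerm])
    rw [this, P.reflection_reflectionPerm, P.reflection_inv]
  | one =>
    intro i j h
    have : j = i := P.root.injective h
    simp [this]
  | mul x y _ hy hx hy' =>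
    intro i j h
    obtain ⟨k, hk⟩ := (exists_root_eq_of_mem_weyl P hy).1 i
    rw [hx k j (by rw [hk, h]; rfl), hy' i k hk]
    group
  | inv x _ hx =>
    intro i j h
    have := hx j i (by rw [h]; exact (LinearEquiv.apply_symm_apply x _).symm)
    rw [this]
    group

/-- The indices of the roots in the orbits of the roots of `s` under `weylOf P s`. -/
def orbitIndices (P : RootPairing ι ℝ V N) (s : Set ι) : Set ι :=
  {i | ∃ w ∈ weylOf P s, ∃ j ∈ s, P.root i = w (P.root j)}

lemma subset_orbitIndices (P : RootPairing ι ℝ V N) (s : Set ι) : s ⊆ orbitIndices P s :=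
  fun i hi ↦ ⟨1, one_mem _, i, hi, rfl⟩

lemma reflection_mem_of_mem_orbitIndices (P : RootPairing ι ℝ V N) {s : Set ι} {i : ι}
    (hi : i ∈ orbitIndices P s) : P.reflection i ∈ weylOf P s := by
  obtain ⟨w, hw, j, hj, h⟩ := hi
  rw [reflection_eq_conj_of_mem_weyl P (weylOf_le_weyl P s hw) j i h]
  exact mul_mem (mul_mem hw (reflection_mem_weylOf P hj)) (inv_mem hw)

lemma reflectionPerm_mem_orbitIndices (P : RootPairing ι ℝ V N) {s : Set ι} {i j : ι}
    (hi : i ∈ orbitIndices P s) (hj : j ∈ orbitIndices P s) :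
    P.reflectionPerm i j ∈ orbitIndices P s := by
  have h := reflection_mem_of_mem_orbitIndices P hi
  obtain ⟨w, hw, k, hk, e⟩ := hj
  refine ⟨P.reflection i * w, mul_mem h hw, k, hk, ?_⟩
  rw [P.root_reflectionPerm, e]
  rfl

lemma isReflectableSet_iff_orbitIndices (P : RootPairing ι ℝ V N) (s : Set ι) :
    IsReflectableSet P s ↔ ∀ i, i ∈ orbitIndices P s := by
  constructor
  · intro h i
    have : P.root i ∈ Set.range P.root := ⟨i, rfl⟩
    rw [← h] at this
    exact this
  · intro h
    refine Set.Subset.antisymm ?_ ?_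
    · rintro v ⟨w, hw, i, -, rfl⟩
      exact (exists_root_eq_of_mem_weyl P (weylOf_le_weyl P s hw)).1 i
    · rintro _ ⟨i, rfl⟩
      exact h i

lemma IsReflectableSet.weylOf_eq_weyl {P : RootPairing ι ℝ V N} {s : Set ι}
    (h : IsReflectableSet P s) : weylOf P s = weyl P := by
  rw [isReflectableSet_iff_orbitIndices] at h
  exact (weylOf_eq_weyl_iff P s).2 fun i ↦ reflection_mem_of_mem_orbitIndices P (h i)

/-! ### Duality between roots and coroots. -/

/-- An element of `weylOf P s` acts on the coweight space through an element of
`weylOf P.flip s`. -/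
lemma exists_contragredient (P : RootPairing ι ℝ V N) {s : Set ι} {w : V ≃ₗ[ℝ] V}
    (hw : w ∈ weylOf P s) :
    ∃ w' ∈ weylOf P.flip s, ∀ x y, P.toLinearMap (w x) (w' y) = P.toLinearMap x y := by
  induction hw using Subgroup.closure_induction with
  | mem w hw =>
    obtain ⟨k, hk, rfl⟩ := hw
    refine ⟨P.flip.reflection k, reflection_mem_weylOf P.flip hk, fun x y ↦ ?_⟩
    rw [P.reflection_apply, P.flip.reflection_apply]
    have h2 : P.toLinearMap (P.root k) (P.coroot k) = 2 := P.root_coroot_two k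
    simp only [RootPairing.coroot', RootPairing.flip, LinearMap.flip_flip, LinearMap.flip_apply,
      map_sub, map_smul, LinearMap.sub_apply, LinearMap.smul_apply, smul_eq_mul, h2]
    ring
  | one => exact ⟨1, one_mem _, fun x y ↦ rfl⟩
  | mul x y _ _ hx hy =>
    obtain ⟨x', hx', h1⟩ := hx
    obtain ⟨y', hy', h2⟩ := hy
    exact ⟨x' * y', mul_mem hx' hy', fun a b ↦ (h1 _ _).trans (h2 _ _)⟩
  | inv x _ hx =>
    obtain ⟨x', hx', h1⟩ := hx
    refine ⟨x'⁻¹, inv_mem hx', fun a b ↦ ?_⟩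
    rw [← h1]
    congr 1
    · exact congrArg _ (LinearEquiv.apply_symm_apply x a)
    · exact LinearEquiv.apply_symm_apply x' b

lemma weylOf_flip_eq_weyl {P : RootPairing ι ℝ V N} {s : Set ι} (h : weylOf P s = weyl P) :
    weylOf P.flip s = weyl P.flip := by
  rw [weylOf_eq_weyl_iff] at h ⊢
  intro i
  obtain ⟨w', hw', hw⟩ := exists_contragredient P (h i)
  convert hw'
  ext y
  have hinj : Function.Injective P.toLinearMap.flip :=
    (LinearMap.IsPerfPair.bijective_right P.toLinearMap).injective
  apply hinj
  ext x
  -- Evaluating at the reflected vector shows that `w'` is the contragredient of `P.reflection i`;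
  -- perfectness of the pairing identifies it with `P.flip.reflection i`.
  have h1 := hw (P.reflection i x) y
  rw [P.reflection_same] at h1
  rw [LinearMap.flip_apply, LinearMap.flip_apply, h1, P.reflection_apply, P.flip.reflection_apply]
  simp only [RootPairing.coroot', RootPairing.flip, LinearMap.flip_flip, LinearMap.flip_apply,
    map_sub, map_smul, LinearMap.sub_apply, LinearMap.smul_apply, smul_eq_mul]
  ring

/-! ### From generating the Weyl group to generating the lattices. -/

/-- Integral weights: the vectors which all coroots map to integers. -/
def IsIntegralWeight (P : RootPairing ι ℝ V N) (x : V) : Prop :=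
  ∀ k, ∃ z : ℤ, P.coroot' k x = z

lemma IsIntegralWeight.reflection {P : RootPairing ι ℝ V N} {x : V}
    (hx : IsIntegralWeight P x) (i : ι) : IsIntegralWeight P (P.reflection i x) := by
  intro k
  rw [P.coroot'_reflection]
  exact hx _

lemma sub_mem_span_of_mem_weylOf (P : RootPairing ι ℝ V N) {s : Set ι} {w : V ≃ₗ[ℝ] V}
    (hw : w ∈ weylOf P s) :
    ∀ x, IsIntegralWeight P x →
      (IsIntegralWeight P (w x) ∧ w x - x ∈ span ℤ (P.root '' s)) ∧
      (IsIntegralWeight P (w⁻¹ x) ∧ w⁻¹ x - x ∈ span ℤ (P.root '' s)) := by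
  induction hw using Subgroup.closure_induction with
  | mem w hw =>
    obtain ⟨k, hk, rfl⟩ := hw
    intro x hx
    rw [P.reflection_inv, and_self]
    refine ⟨hx.reflection k, ?_⟩
    obtain ⟨z, hz⟩ := hx k
    rw [P.reflection_apply, sub_sub_cancel_left, hz, neg_mem_iff, Int.cast_smul_eq_zsmul]
    exact smul_mem _ _ (subset_span ⟨k, hk, rfl⟩)
  | one =>
    intro x hx
    simpa using hx
  | mul a b _ _ ha hb =>
    intro x hx
    refine ⟨⟨(ha _ (hb x hx).1.1).1.1, ?_⟩, ?_⟩
    · have := add_mem (ha _ (hb x hx).1.1).1.2 (hb x hx).1.2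
      rwa [sub_add_sub_cancel] at this
    · rw [mul_inv_rev]
      refine ⟨(hb _ (ha x hx).2.1).2.1, ?_⟩
      have := add_mem (hb _ (ha x hx).2.1).2.2 (ha x hx).2.2
      rwa [sub_add_sub_cancel] at this
  | inv a _ ha =>
    intro x hx
    rw [inv_inv]
    exact (ha x hx).symm

/-- A simple root has its fundamental weight; reflections carry this weight to the other roots. -/
lemma exists_isIntegralWeight_eq_one [Finite ι] (P : RootPairing ι ℝ V N) [P.IsRootSystem]
    [P.IsCrystallographic] [P.IsReduced] (i : ι) :
    ∃ x, IsIntegralWeight P x ∧ P.coroot' i x = 1 := by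
  classical
  obtain ⟨b⟩ := P.nonempty_base
  refine b.induction_reflect i (p := fun i ↦ ∃ x, IsIntegralWeight P x ∧ P.coroot' i x = 1)
    ?_ ?_ ?_
  · rintro i ⟨x, hx, h⟩
    exact ⟨P.reflection i x, hx.reflection i, by
      rw [P.coroot'_reflection, P.reflectionPerm_self, h]⟩
  · intro i hi
    obtain ⟨x, hx⟩ := (LinearMap.IsPerfPair.bijective_left P.toLinearMap).surjective
      (b.toCoweightBasis.coord ⟨i, hi⟩)
    have key (j : b.support) : P.toLinearMap x (P.coroot j) = if j = ⟨i, hi⟩ then 1 else 0 := by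
      rw [hx, Module.Basis.coord_apply, b.toCoweightBasis_repr_coroot, Finsupp.single_apply]
    refine ⟨x, fun k ↦ ?_, by simpa using key ⟨i, hi⟩⟩
    have hk := b.coroot_mem_span_int k
    rw [LinearMap.flip_apply]
    generalize P.coroot k = y at hk
    induction hk using span_induction with
    | mem y hy =>
      obtain ⟨j, hj, rfl⟩ := hy
      rw [key ⟨j, hj⟩]
      split_ifs
      exacts [⟨1, by simp⟩, ⟨0, by simp⟩]
    | zero => exact ⟨0, by simp⟩
    | add y z _ _ hy hz =>
      obtain ⟨m, hm⟩ := hy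
      obtain ⟨n, hn⟩ := hz
      exact ⟨m + n, by rw [map_add, hm, hn]; push_cast; rfl⟩
    | smul a y _ hy =>
      obtain ⟨m, hm⟩ := hy
      exact ⟨a * m, by rw [map_zsmul, hm]; simp⟩
  · rintro i j ⟨x, hx, h⟩ -
    exact ⟨P.reflection j x, hx.reflection j, by
      rw [P.coroot'_reflection, P.reflectionPerm_self, h]⟩

/-- If the reflections in the roots of `s` generate the Weyl group, then the roots of `s` generate
the root lattice. -/
lemma root_mem_span_of_weylOf_eq_weyl [Finite ι] {P : RootPairing ι ℝ V N} [P.IsRootSystem]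
    [P.IsCrystallographic] [P.IsReduced] {s : Set ι} (h : weylOf P s = weyl P) (i : ι) :
    P.root i ∈ span ℤ (P.root '' s) := by
  obtain ⟨x, hx, hxi⟩ := exists_isIntegralWeight_eq_one P i
  have := (sub_mem_span_of_mem_weylOf P ((weylOf_eq_weyl_iff P s).1 h i) x hx).1.2
  rwa [P.reflection_apply, hxi, one_smul, sub_sub_cancel_left, neg_mem_iff] at this

/-! ### From generating the lattices to reflectability. -/

/-- The roots of `s` generate the root lattice and the coroots of `s` generate the coroot
lattice. -/
def GeneratesLattices (P : RootPairing ι ℝ V N) (s : Set ι) : Prop :=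
  (∀ i, P.root i ∈ span ℤ (P.root '' s)) ∧ ∀ i, P.coroot i ∈ span ℤ (P.coroot '' s)

/-- A root is short when it is no longer than any root which is not orthogonal to it. -/
def IsShort (P : RootPairing ι ℝ V N) (i : ι) : Prop :=
  ∀ k, |P.pairing i k| ≤ |P.pairing k i|

lemma generatesLattices_of_weylOf_eq_weyl [Finite ι] {P : RootPairing ι ℝ V N} [P.IsRootSystem]
    [P.IsCrystallographic] [P.IsReduced] {s : Set ι} (h : weylOf P s = weyl P) :
    GeneratesLattices P s :=
  ⟨root_mem_span_of_weylOf_eq_weyl h, fun i ↦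
    root_mem_span_of_weylOf_eq_weyl (P := P.flip) (weylOf_flip_eq_weyl h) i⟩

/-- The injection `e`, twice the polarization, turns relations among roots into relations among
coroots weighted by the squared lengths. -/
lemma exists_invariantForm_pos [Finite ι] (P : RootPairing ι ℝ V N) [P.IsRootSystem] :
    ∃ B : P.InvariantForm, (∀ i, 0 < B.form (P.root i) (P.root i)) ∧
      (∀ x, 0 ≤ B.form x x) ∧ ∃ e : V →ₗ[ℝ] N, Function.Injective e ∧
      ∀ i, B.form (P.root i) (P.root i) • P.coroot i = e (P.root i) := by
  have : Fintype ι := Fintype.ofFinite ι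
  refine ⟨(P.posRootForm ℝ).toInvariantForm, fun i ↦ ?_, P.zero_le_rootForm,
    (2 : ℝ) • P.Polarization, fun x y h ↦ P.PolarizationEquiv.injective ?_, fun i ↦ ?_⟩
  · exact P.rootForm_pos_of_ne_zero (subset_span ⟨i, rfl⟩) (P.ne_zero i)
  · rw [P.polarizationEquiv_apply, P.polarizationEquiv_apply]
    exact smul_right_injective N (two_ne_zero (α := ℝ)) h
  · exact (P.rootForm_self_smul_coroot i).trans (by simp [two_smul])

lemma two_mul_invariantForm_apply_root (P : RootPairing ι ℝ V N) (B : P.InvariantForm) (x : V)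
    (i : ι) :
    2 * B.form x (P.root i) = P.coroot' i x * B.form (P.root i) (P.root i) := by
  have := B.apply_reflection_reflection i x (P.root i)
  rw [P.reflection_apply_self, P.reflection_apply, map_neg, map_sub, LinearMap.sub_apply,
    map_smul, LinearMap.smul_apply, smul_eq_mul] at this
  linarith

/-- Only two root lengths occur, so each root is of minimal or of maximal length; passing to coroots
reverses the order of lengths. -/
lemma isShort_or_isShort_flip [Finite ι] (P : RootPairing ι ℝ V N) [P.IsRootSystem]
    [P.IsCrystallographic] [P.IsReduced] [P.IsIrreducible] (i : ι) :
    IsShort P i ∨ IsShort P.flip i := by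
  obtain ⟨B, hB, -, -⟩ := exists_invariantForm_pos P
  have hne : Nonempty ι := ⟨i⟩
  obtain ⟨a, b, hab⟩ := B.exists_apply_eq_or
  have key (k) : |P.pairing i k| * B.form (P.root k) (P.root k) =
      |P.pairing k i| * B.form (P.root i) (P.root i) := by
    have := congrArg abs (B.pairing_mul_eq_pairing_mul_swap k i)
    rwa [abs_mul, abs_mul, abs_of_pos (hB i), abs_of_pos (hB k)] at this
  have h : (∀ k, B.form (P.root i) (P.root i) ≤ B.form (P.root k) (P.root k)) ∨
      ∀ k, B.form (P.root k) (P.root k) ≤ B.form (P.root i) (P.root i) := by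
    by_contra! hc
    obtain ⟨⟨k, hk⟩, l, hl⟩ := hc
    rcases hab i with hi | hi <;> rcases hab k with hk' | hk' <;> rcases hab l with hl' | hl' <;>
      linarith
  refine h.imp (fun h k ↦ ?_) (fun h k ↦ ?_)
  · refine le_of_mul_le_mul_right ?_ (hB k)
    rw [key k]
    exact mul_le_mul_of_nonneg_left (h k) (abs_nonneg _)
  · rw [P.pairing_flip, P.pairing_flip]
    refine le_of_mul_le_mul_right ?_ (hB i)
    rw [← key k]
    exact mul_le_mul_of_nonneg_left (h k) (abs_nonneg _)

lemma IsShort.pairing_eq_one [Finite ι] {P : RootPairing ι ℝ V N} [P.IsCrystallographic]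
    [P.IsReduced] {i k : ι} (hi : IsShort P i) (hik : i ≠ k) (h : 0 < P.pairing k i) :
    P.pairing i k = 1 := by
  have : Module.IsReflexive ℝ V := .of_isPerfPair P.toLinearMap
  have h1 := P.pairingIn_pairingIn_mem_set_of_isCrystal_of_isRed i k
  have h2 := hi k
  have h3 : ¬ (P.pairingIn ℤ i k = 2 ∧ P.pairingIn ℤ k i = 2) := by
    rwa [P.pairingIn_two_two_iff]
  rw [pairing_eq_intCast] at h h2 ⊢
  rw [pairing_eq_intCast P k i] at h2
  norm_cast at h h2 ⊢
  simp only [Set.mem_insert_iff, Set.mem_singleton_iff, Prod.mk.injEq] at h1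
  grind

/-- A set of roots closed under its own reflections contains every short root which is a sum of
roots in the set. -/
lemma IsShort.mem_of_list_sum_eq [Finite ι] {P : RootPairing ι ℝ V N} [P.IsCrystallographic]
    [P.IsReduced] {t : Set ι} (ht : ∀ i ∈ t, ∀ j ∈ t, P.reflectionPerm i j ∈ t) (n : ℕ) :
    ∀ (l : Multiset V) (i : ι), Multiset.card l = n → (∀ x ∈ l, x ∈ P.root '' t) →
      IsShort P i → l.sum = P.root i → i ∈ t := by
  induction n with
  | zero =>
    intro l i hl _ _ hs
    rw [Multiset.card_eq_zero] at hl
    rw [hl] at hs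
    exact absurd hs.symm (P.ne_zero i)
  | succ n ih =>
    intro l i hl hlt hi hs
    have hsum : 0 < (l.map (P.coroot' i)).sum := by
      rw [← map_multiset_sum, hs]
      simp
    obtain ⟨y, hy, hpos⟩ : ∃ y ∈ l, 0 < P.coroot' i y := by
      by_contra! hc
      refine hsum.not_ge ((Multiset.sum_le_card_nsmul _ 0 fun x hx ↦ ?_).trans (by simp))
      obtain ⟨y, hy, rfl⟩ := Multiset.mem_map.1 hx
      exact hc y hy
    obtain ⟨k, hk, rfl⟩ := hlt y hy
    by_cases hik : i = k
    · exact hik ▸ hk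
    have h1 := hi.pairing_eq_one hik hpos
    obtain ⟨m, rfl⟩ := Multiset.exists_cons_of_mem hy
    -- Since the pairing is 1, reflecting subtracts the summand `P.root k`: the result is again
    -- short and is the sum of the remaining `n` roots.
    have hmem : P.reflectionPerm k i ∈ t := by
      refine ih m _ (by simpa using hl) (fun x hx ↦ hlt x (Multiset.mem_cons_of_mem hx)) ?_ ?_
      · intro j
        have := hi (P.reflectionPerm k j)
        rwa [P.pairing_reflectionPerm, ← P.pairing_reflectionPerm k j i] at this
      · rw [P.root_reflectionPerm, P.reflection_apply_root, h1, one_smul, ← hs,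
          Multiset.sum_cons, add_sub_cancel_left]
    simpa using ht k hk _ hmem

lemma IsShort.mem_of_mem_span [Finite ι] {P : RootPairing ι ℝ V N} [P.IsCrystallographic]
    [P.IsReduced] {t : Set ι} (ht : ∀ i ∈ t, ∀ j ∈ t, P.reflectionPerm i j ∈ t) {i : ι}
    (hi : IsShort P i) (hs : P.root i ∈ span ℤ (P.root '' t)) : i ∈ t := by
  -- Closure under negation makes integral combinations into sums of roots of `t`, without signs.
  have hneg : -(P.root '' t) ⊆ P.root '' t := by
    rintro x ⟨j, hj, hx⟩
    exact ⟨P.reflectionPerm j j, ht j hj j hj, by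
      rw [P.root_reflectionPerm, P.reflection_apply_self, hx, neg_neg]⟩
  rw [← mem_toAddSubgroup, span_int_eq_addSubgroupClosure, ← AddSubgroup.mem_toAddSubmonoid,
    AddSubgroup.closure_toAddSubmonoid, Set.union_eq_self_of_subset_right hneg] at hs
  obtain ⟨l, hl, hs⟩ := AddSubmonoid.exists_multiset_of_mem_closure hs
  exact IsShort.mem_of_list_sum_eq ht _ l i rfl hl hi hs

lemma GeneratesLattices.isReflectableSet [Finite ι] {P : RootPairing ι ℝ V N} [P.IsRootSystem]
    [P.IsCrystallographic] [P.IsReduced] [P.IsIrreducible] {s : Set ι}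
    (h : GeneratesLattices P s) : IsReflectableSet P s := by
  rw [isReflectableSet_iff_orbitIndices]
  intro i
  have ht : ∀ i ∈ orbitIndices P s, ∀ j ∈ orbitIndices P s,
      P.reflectionPerm i j ∈ orbitIndices P s :=
    fun i hi j hj ↦ reflectionPerm_mem_orbitIndices P hi hj
  rcases isShort_or_isShort_flip P i with hi | hi
  · exact hi.mem_of_mem_span ht (span_mono (Set.image_mono (subset_orbitIndices P s)) (h.1 i))
  · exact hi.mem_of_mem_span (P := P.flip) ht
      (span_mono (Set.image_mono (subset_orbitIndices P s)) (h.2 i))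

lemma weylOf_eq_weyl_iff_generatesLattices [Finite ι] (P : RootPairing ι ℝ V N) [P.IsRootSystem]
    [P.IsCrystallographic] [P.IsReduced] [P.IsIrreducible] (s : Set ι) :
    weylOf P s = weyl P ↔ GeneratesLattices P s :=
  ⟨generatesLattices_of_weylOf_eq_weyl, fun h ↦ h.isReflectableSet.weylOf_eq_weyl⟩

lemma weylOf_eq_weyl_iff_isReflectableSet [Finite ι] (P : RootPairing ι ℝ V N) [P.IsRootSystem]
    [P.IsCrystallographic] [P.IsReduced] [P.IsIrreducible] (s : Set ι) :
    weylOf P s = weyl P ↔ IsReflectableSet P s :=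
  ⟨fun h ↦ (generatesLattices_of_weylOf_eq_weyl h).isReflectableSet, fun h ↦ h.weylOf_eq_weyl⟩

/-! ### Primitive circuits and their unit coefficients. -/

lemma exists_eq_mul_primitive {κ : Type*} [Fintype κ] (c : κ → ℤ) (hc : c ≠ 0) :
    ∃ (g : ℤ) (d w : κ → ℤ), g ≠ 0 ∧ (∀ i, c i = g * d i) ∧ ∑ i, w i * d i = 1 := by
  obtain ⟨g, hg⟩ := IsPrincipalIdealRing.principal (Ideal.span (Set.range c))
  have hmem (i) : c i ∈ Ideal.span (Set.range c) := Ideal.subset_span ⟨i, rfl⟩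
  have hdvd (i) : ∃ e, c i = g * e := by
    have := hmem i
    rw [hg, Ideal.submodule_span_eq, Ideal.mem_span_singleton] at this
    exact this
  choose d hd using hdvd
  have hgm : g ∈ Ideal.span (Set.range c) := by
    rw [hg]
    exact mem_span_singleton_self g
  obtain ⟨w, hw⟩ := Ideal.mem_span_range_iff_exists_fun.1 hgm
  have hg0 : g ≠ 0 := by
    rintro rfl
    exact hc (funext fun i ↦ by simp [hd i])
  refine ⟨g, d, w, hg0, hd, mul_left_cancel₀ hg0 ?_⟩
  rw [Finset.mul_sum, mul_one]
  refine (Finset.sum_congr rfl fun i _ ↦ ?_).trans hw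
  rw [hd i]
  ring

/-- If all linear relations between the vectors `v i` are multiples of one relation `d`, then there
is a linear form with prescribed values `q i` at `v i` as soon as `d` annihilates `q`. -/
lemma exists_linearMap_apply_eq {κ : Type*} [Fintype κ] {v : κ → V} {d q : κ → ℝ}
    (hcirc : ∀ a : κ → ℝ, ∑ i, a i • v i = 0 → ∃ t, ∀ i, a i = t * d i)
    (hq : ∑ i, d i * q i = 0) : ∃ f : V →ₗ[ℝ] ℝ, ∀ i, f (v i) = q i := by
  classical
  let T := Fintype.linearCombination ℝ v
  let φ : (κ → ℝ) →ₗ[ℝ] ℝ := Fintype.linearCombination ℝ q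
  have hφ : φ ∈ T.dualMap.range := by
    rw [LinearMap.range_dualMap_eq_dualAnnihilator_ker, mem_dualAnnihilator]
    intro a ha
    obtain ⟨t, ht⟩ := hcirc a ha
    have : φ a = t * ∑ i, d i * q i := by
      simp only [φ, Fintype.linearCombination_apply, smul_eq_mul, Finset.mul_sum, ht, mul_assoc]
    rw [this, hq, mul_zero]
  obtain ⟨f, hf⟩ := hφ
  refine ⟨f, fun i ↦ ?_⟩
  have := LinearMap.congr_fun hf (Pi.single i 1)
  simpa [T, φ] using this

/-- A primitive circuit of roots has a coefficient `1` or `-1`. -/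
lemma exists_isUnit_of_circuit [Finite ι] (P : RootPairing ι ℝ V N) [P.IsRootSystem]
    [P.IsCrystallographic] {κ : Type*} [Fintype κ] (e : κ → ι) (d w₀ : κ → ℤ)
    (hd : ∑ i, d i • P.root (e i) = 0)
    (hcirc : ∀ a : κ → ℝ, ∑ i, a i • P.root (e i) = 0 → ∃ t : ℝ, ∀ i, a i = t * d i)
    (hw₀ : ∑ i, w₀ i * d i = 1) : ∃ i, IsUnit (d i) := by
  classical
  obtain ⟨B, hB, hB0, -⟩ := exists_invariantForm_pos P.flip
  have hB2 : ∀ (x : N) (i : ι), 2 * B.form x (P.coroot i) =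
      P.toLinearMap (P.root i) x * B.form (P.coroot i) (P.coroot i) :=
    two_mul_invariantForm_apply_root P.flip B
  replace hB : ∀ i, 0 < B.form (P.coroot i) (P.coroot i) := hB
  have hne : Nonempty κ := by
    by_contra h
    rw [not_nonempty_iff] at h
    simp at hw₀
  have hrel (x : N) : ∑ i, (d i : ℝ) * P.toLinearMap (P.root (e i)) x = 0 := by
    have := congrArg (fun v ↦ P.toLinearMap v x) hd
    simpa [map_sum, LinearMap.sum_apply] using this
  -- The point `p`, with coordinates of the same signs as the coefficients of the circuit.
  obtain ⟨D, hD, hDd⟩ : ∃ D : ℝ, 0 < D ∧ ∑ i, (d i : ℝ) * (d i / D) = 1 := by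
    have hpos : 0 < ∑ i, (d i : ℝ) * d i := by
      refine (Finset.sum_nonneg fun i _ ↦ mul_self_nonneg (d i : ℝ)).lt_of_ne' fun h ↦ ?_
      rw [Finset.sum_eq_zero_iff_of_nonneg fun i _ ↦ mul_self_nonneg (d i : ℝ)] at h
      have h0 (i) : d i = 0 := by simpa using h i (Finset.mem_univ i)
      simp [h0] at hw₀
    refine ⟨_, hpos, ?_⟩
    simp_rw [← mul_div_assoc, ← Finset.sum_div]
    exact div_self hpos.ne'
  -- Integer solutions of `∑ i, w i * d i = 1` arise as `w₀ i` plus the pairings with a point `x` of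
  -- `S`; the difference from `p` is then the vector of pairings with `x - μ`. The solution sought
  -- has all products `w i * d i` nonnegative, so it is taken with `x` close to `μ`.
  obtain ⟨μ, hμ⟩ : ∃ μ : N, ∀ i, P.toLinearMap (P.root (e i)) μ = d i / D - w₀ i := by
    have hw₀' : ∑ i, (d i : ℝ) * w₀ i = 1 := by
      simp_rw [mul_comm (d _ : ℝ)]
      exact_mod_cast hw₀
    obtain ⟨f, hf⟩ := exists_linearMap_apply_eq (v := fun i ↦ P.root (e i))
      (q := fun i ↦ d i / D - w₀ i) hcirc (by
        simp_rw [mul_sub, Finset.sum_sub_distrib]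
        rw [hDd, hw₀', sub_self])
    obtain ⟨μ, rfl⟩ := (LinearMap.IsPerfPair.bijective_right P.toLinearMap).surjective f
    exact ⟨μ, hf⟩
  obtain ⟨i₀, hi₀⟩ := Finite.exists_min fun i ↦ B.form (P.coroot (e i)) (P.coroot (e i))
  -- The least possible drop of `f` in the descent below; a point within `ε` of the infimum
  -- suffices, so no minimum need be attained.
  set ε := B.form (P.coroot (e i₀)) (P.coroot (e i₀)) / D with hε
  have hε0 : 0 < ε := div_pos (hB _) hD
  let S : Set N := {x | ∀ i, ∃ z : ℤ, P.toLinearMap (P.root (e i)) x = z}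
  let f : N → ℝ := fun x ↦ B.form (x - μ) (x - μ)
  obtain ⟨x, hxS, hx⟩ : ∃ x ∈ S, f x < sInf (f '' S) + ε := by
    obtain ⟨_, ⟨x, hx, rfl⟩, h⟩ := exists_lt_of_csInf_lt (s := f '' S)
      ⟨f 0, 0, fun i ↦ ⟨0, by simp⟩, rfl⟩ (lt_add_of_pos_right _ hε0)
    exact ⟨x, hx, h⟩
  choose z hz using hxS
  have hnonneg (i) : 0 ≤ (w₀ i + z i) * d i := by
    by_contra! hneg
    -- Subtracting this multiple of the coroot changes `f` by exactly `(w₀ i + z i) * d i` times the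
    -- squared coroot length over `D`; a negative integer factor would push `f` below its infimum.
    let y := x - (w₀ i + z i) • P.coroot (e i)
    have hyS : y ∈ S := by
      intro j
      refine ⟨z j - (w₀ i + z i) * P.pairingIn ℤ (e j) (e i), ?_⟩
      rw [map_sub, map_zsmul, hz, P.root_coroot_eq_pairing, pairing_eq_intCast]
      simp
    have hfy : f y = f x + (((w₀ i + z i) * d i : ℤ) : ℝ) *
        (B.form (P.coroot (e i)) (P.coroot (e i)) / D) := by
      have h1 := hB2 (x - μ) (e i)
      rw [map_sub (P.toLinearMap _), hz, hμ] at h1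
      have h2 : B.form (P.coroot (e i)) (x - μ) = B.form (x - μ) (P.coroot (e i)) := by
        rw [← B.symm.eq]
        rfl
      have h3 : y - μ = (x - μ) - ((w₀ i + z i : ℤ) : ℝ) • P.coroot (e i) := by
        rw [Int.cast_smul_eq_zsmul]
        simp only [y]
        abel
      simp only [f, h3]
      have h4 : B.form (x - μ) (P.coroot (e i)) = (z i - (d i / D - w₀ i)) *
          B.form (P.coroot (e i)) (P.coroot (e i)) / 2 := by linarith
      generalize x - μ = u at h2 h4
      simp only [map_sub, map_smul, LinearMap.sub_apply, LinearMap.smul_apply, smul_eq_mul, h2, h4]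
      push_cast
      ring
    have hle : sInf (f '' S) ≤ f y :=
      csInf_le ⟨0, by rintro _ ⟨v, -, rfl⟩; exact hB0 _⟩ ⟨y, hyS, rfl⟩
    have hm1 : (((w₀ i + z i) * d i : ℤ) : ℝ) ≤ -1 := by
      exact_mod_cast Int.le_sub_one_of_lt hneg
    have hεi : ε ≤ B.form (P.coroot (e i)) (P.coroot (e i)) / D := by
      rw [hε]
      gcongr
      exact hi₀ i
    nlinarith
  have hsum : ∑ i, (w₀ i + z i) * d i = 1 := by
    have h1 := hrel x
    simp_rw [hz] at h1
    have h2 : ∑ i, d i * z i = 0 := by exact_mod_cast h1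
    simp_rw [add_mul, Finset.sum_add_distrib, hw₀]
    simp_rw [mul_comm (z _), h2, add_zero]
  -- Nonnegative integers with sum 1: one of them equals 1, which makes its factor `d i` a unit.
  obtain ⟨i, hi⟩ : ∃ i, (w₀ i + z i) * d i ≠ 0 := by
    by_contra! h
    simp [h] at hsum
  have hi1 : (w₀ i + z i) * d i ≤ 1 := hsum ▸
    Finset.single_le_sum (fun j _ ↦ hnonneg j) (Finset.mem_univ i)
  refine ⟨i, IsUnit.of_mul_eq_one (w₀ i + z i) ?_⟩
  have := hnonneg i
  rw [mul_comm]
  omega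

/-! ### Root lengths, circuits and superfluous roots. -/

/-- The root lengths are integral multiples, by `1` or by a fixed prime, of a fixed real number. -/
lemma exists_length_eq_mul [Finite ι] {P : RootPairing ι ℝ V N} [P.IsCrystallographic]
    [P.IsReduced] [P.IsIrreducible] [Nonempty ι] (B : P.InvariantForm)
    (hB : ∀ i, 0 < B.form (P.root i) (P.root i)) :
    ∃ b : ℝ, 0 < b ∧ ∃ r : ℤ, (r = 1 ∨ Prime r) ∧ ∃ n : ι → ℤ, (∀ i, n i = 1 ∨ n i = r) ∧
      ∀ i, B.form (P.root i) (P.root i) = b * n i := by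
  obtain ⟨i, j, hij⟩ := B.exists_apply_eq_or
  have key : ∀ i j : ι, ∀ r : ℤ, (r = 1 ∨ Prime r) →
      B.form (P.root j) (P.root j) = r * B.form (P.root i) (P.root i) →
      (∀ k, B.form (P.root k) (P.root k) = B.form (P.root i) (P.root i) ∨
        B.form (P.root k) (P.root k) = B.form (P.root j) (P.root j)) →
      ∃ b : ℝ, 0 < b ∧ ∃ r : ℤ, (r = 1 ∨ Prime r) ∧ ∃ n : ι → ℤ, (∀ i, n i = 1 ∨ n i = r) ∧
        ∀ i, B.form (P.root i) (P.root i) = b * n i := by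
    intro i j r hr h1 h2
    have (k : ι) : ∃ m : ℤ, (m = 1 ∨ m = r) ∧
        B.form (P.root k) (P.root k) = B.form (P.root i) (P.root i) * m := by
      rcases h2 k with h | h
      · exact ⟨1, Or.inl rfl, by simp [h]⟩
      · exact ⟨r, Or.inr rfl, by rw [h, h1, mul_comm]⟩
    choose n hn hn' using this
    exact ⟨_, hB i, r, hr, n, hn, hn'⟩
  rcases B.apply_eq_or i j with h | h | h | h | h
  · exact key i j 1 (Or.inl rfl) (by simp [h]) hij
  · exact key j i 2 (Or.inr Int.prime_two) (by simp [h]) fun k ↦ (hij k).symm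
  · exact key j i 3 (Or.inr Int.prime_three) (by simp [h]) fun k ↦ (hij k).symm
  · exact key i j 2 (Or.inr Int.prime_two) (by simp [h]) hij
  · exact key i j 3 (Or.inr Int.prime_three) (by simp [h]) hij

/-- A nontrivial real linear relation between roots yields an integral one. -/
lemma exists_int_relation [Finite ι] (P : RootPairing ι ℝ V N) [P.IsRootSystem]
    [P.IsCrystallographic] {κ : Type*} [Fintype κ] (e : κ → ι) (a : κ → ℝ) (ha : a ≠ 0)
    (h : ∑ i, a i • P.root (e i) = 0) :
    ∃ c : κ → ℤ, c ≠ 0 ∧ ∑ i, c i • P.root (e i) = 0 := by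
  obtain ⟨i₁, hi₁⟩ := Function.ne_iff.1 ha
  -- The pairings are integers, so any `ℚ`-linear form on `ℝ` carries the real relation to a
  -- rational one; this form keeps it nonzero.
  obtain ⟨φ, hφ⟩ : ∃ φ : ℝ →ₗ[ℚ] ℚ, φ (a i₁) ≠ 0 := by
    by_contra! hc
    exact hi₁ ((Module.forall_dual_apply_eq_zero_iff ℚ (a i₁)).1 hc)
  obtain ⟨D, hD⟩ := IsLocalization.exist_integer_multiples_of_finite (nonZeroDivisors ℤ)
    fun i ↦ φ (a i)
  choose c hc using hD
  have hD0 : ((D : ℤ) : ℚ) ≠ 0 := by exact_mod_cast nonZeroDivisors.coe_ne_zero D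
  have hc' (i) : (c i : ℚ) = (D : ℤ) * φ (a i) := by
    have := hc i
    rwa [zsmul_eq_mul] at this
  refine ⟨c, fun h0 ↦ ?_, P.eq_zero_iff_forall_coroot'_eq_zero.2 fun k ↦ ?_⟩
  · have := hc' i₁
    rw [h0] at this
    exact mul_ne_zero hD0 hφ (by simpa using this.symm)
  · have h1 := congrArg (P.coroot' k) h
    simp only [map_sum, map_smul, P.root_coroot'_eq_pairing, pairing_eq_intCast, smul_eq_mul,
      map_zero] at h1
    have h2 : ∑ i, φ (a i) * P.pairingIn ℤ (e i) k = 0 := by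
      have := congrArg φ h1
      simp only [map_sum, map_zero] at this
      rw [← this]
      refine Finset.sum_congr rfl fun i _ ↦ ?_
      rw [mul_comm (a i), ← zsmul_eq_mul, map_zsmul, zsmul_eq_mul, mul_comm]
    have h3 : ∑ i, c i * P.pairingIn ℤ (e i) k = 0 := by
      have h4 : ∑ i, (c i : ℚ) * P.pairingIn ℤ (e i) k = 0 := by
        simp_rw [hc', mul_assoc, ← Finset.mul_sum, h2, mul_zero]
      exact_mod_cast h4
    simp only [map_sum, map_zsmul, P.root_coroot'_eq_pairing, pairing_eq_intCast, zsmul_eq_mul]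
    exact_mod_cast h3

/-- A linearly dependent set of roots contains a circuit. -/
lemma exists_circuit [Finite ι] (P : RootPairing ι ℝ V N) [P.IsRootSystem]
    [P.IsCrystallographic] {s : Set ι} (hs : ¬ LinearIndepOn ℝ P.root s) :
    ∃ (t : Finset ι) (c : t → ℤ), (t : Set ι) ⊆ s ∧ c ≠ 0 ∧ ∑ i, c i • P.root i = 0 ∧
      ∀ a : t → ℝ, ∑ i, a i • P.root i = 0 → ∃ τ : ℝ, ∀ i, a i = τ * c i := by
  classical
  rw [linearIndepOn_iff_linearIndepOn_finset] at hs
  push Not at hs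
  obtain ⟨t₀, ht₀, hdep⟩ := hs
  obtain ⟨t, htt, ht⟩ := exists_minimal_le_of_wellFoundedLT
    (fun t : Finset ι ↦ ¬ LinearIndepOn ℝ P.root (t : Set ι)) t₀ hdep
  obtain ⟨a, ha, hane⟩ : ∃ a : t → ℝ, ∑ i, a i • P.root i = 0 ∧ a ≠ 0 := by
    have h1 : ¬ LinearIndependent ℝ (fun i : t ↦ P.root i) := ht.prop
    rw [Fintype.linearIndependent_iff] at h1
    push Not at h1
    obtain ⟨a, ha, i, hi⟩ := h1
    exact ⟨a, ha, fun h ↦ hi (by simp [h])⟩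
  obtain ⟨c, hc, hc'⟩ := exists_int_relation P (fun i : t ↦ (i : ι)) a hane ha
  refine ⟨t, c, fun i hi ↦ ht₀ (htt hi), hc, hc', fun b hb ↦ ?_⟩
  obtain ⟨i₀, hi₀⟩ := Function.ne_iff.1 hc
  have hi₀' : (c i₀ : ℝ) ≠ 0 := by exact_mod_cast hi₀
  refine ⟨b i₀ / c i₀, fun i ↦ ?_⟩
  have hind : LinearIndepOn ℝ P.root (t.erase i₀ : Finset ι) := by
    by_contra hcon
    exact (Finset.erase_ssubset i₀.2).not_subset (ht.le_of_le hcon (Finset.erase_subset _ _))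
  -- Subtracting the multiple of `c` that cancels the coefficient at `i₀` leaves a relation on an
  -- independent set.
  let f : ι → ℝ := fun j ↦ if hj : j ∈ t then b ⟨j, hj⟩ - b i₀ / c i₀ * c ⟨j, hj⟩ else 0
  have hf (j : t) : f j = b j - b i₀ / c i₀ * c j := by simp [f]
  have hf0 : f i₀ = 0 := by
    rw [hf, div_mul_cancel₀ _ hi₀', sub_self]
  have hsum : ∑ j ∈ t.erase i₀, f j • P.root j = 0 := by
    rw [Finset.sum_erase _ (by rw [hf0, zero_smul]), ← Finset.sum_coe_sort]
    simp_rw [hf, sub_smul, Finset.sum_sub_distrib, hb, mul_smul, ← Finset.smul_sum,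
      Int.cast_smul_eq_zsmul]
    rw [hc', smul_zero, sub_zero]
  have h0 := linearIndepOn_finset_iff.1 hind f hsum
  have : f i = 0 := by
    by_cases h : (i : ι) = i₀
    · rw [h, hf0]
    · exact h0 i (Finset.mem_erase.2 ⟨h, i.2⟩)
  rw [hf] at this
  linarith

/-- A linearly dependent set of roots contains a root which is superfluous for generating both the
root lattice and the coroot lattice. -/
lemma exists_unit_relations [Finite ι] (P : RootPairing ι ℝ V N) [P.IsRootSystem]
    [P.IsCrystallographic] [P.IsReduced] [P.IsIrreducible] {s : Set ι}
    (hs : ¬ LinearIndepOn ℝ P.root s) :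
    ∃ (t : Finset ι) (c d : t → ℤ), (t : Set ι) ⊆ s ∧ ∑ i, c i • P.root i = 0 ∧
      ∑ i, d i • P.coroot i = 0 ∧ ∃ i, IsUnit (c i) ∧ IsUnit (d i) := by
  obtain ⟨t, c₀, hts, hc₀, hc₀rel, hcirc₀⟩ := exists_circuit P hs
  obtain ⟨g₀, c, w, hg₀, hcg, hw⟩ := exists_eq_mul_primitive c₀ hc₀
  have hcrel : ∑ i, c i • P.root i = 0 := by
    simp_rw [hcg, mul_smul, ← Finset.smul_sum] at hc₀rel
    rw [← Int.cast_smul_eq_zsmul ℝ] at hc₀rel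
    exact (smul_eq_zero.1 hc₀rel).resolve_left (by exact_mod_cast hg₀)
  have hcirc : ∀ a : t → ℝ, ∑ i, a i • P.root i = 0 → ∃ τ : ℝ, ∀ i, a i = τ * c i := by
    intro a ha
    obtain ⟨τ, hτ⟩ := hcirc₀ a ha
    exact ⟨τ * g₀, fun i ↦ by rw [hτ, hcg]; push_cast; ring⟩
  have hne : Nonempty ι := by
    obtain ⟨i, -⟩ := Function.ne_iff.1 hc₀
    exact ⟨i⟩
  obtain ⟨B, hB, -, e, he, hBe⟩ := exists_invariantForm_pos P
  obtain ⟨b, hb, r, hr, n, hn, hBn⟩ := exists_length_eq_mul B hB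
  have hn0 (i) : (n i : ℝ) ≠ 0 := by
    intro h
    have := hB i
    rw [hBn, h, mul_zero] at this
    exact this.false
  have hr0 : r ≠ 0 := hr.elim (fun h ↦ by simp [h]) fun h ↦ h.ne_zero
  -- Through `e`, the root circuit `c` becomes the coroot circuit with coefficients `c i * n i`; `d`
  -- is its primitive form.
  obtain ⟨g, d, v, hg, hdg, hv⟩ := exists_eq_mul_primitive (fun i : t ↦ c i * n i) (by
    obtain ⟨i, hi⟩ := Function.ne_iff.1 hc₀
    refine Function.ne_iff.2 ⟨i, mul_ne_zero ?_ (by exact_mod_cast hn0 i)⟩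
    rintro h
    exact hi (by simp [hcg, h]))
  have hg' : (g : ℝ) ≠ 0 := by exact_mod_cast hg
  have hBe' (i) : (b * n i) • P.coroot i = e (P.root i) := by rw [← hBn, hBe]
  have hdrel : ∑ i, d i • P.coroot i = 0 := by
    have h1 := congrArg e hcrel
    simp only [map_sum, map_zsmul, map_zero] at h1
    simp only [← hBe', ← Int.cast_smul_eq_zsmul ℝ, smul_smul] at h1
    have h2 (i : t) : (c i : ℝ) * (b * n i) = (b * g) * d i := by
      have : (c i : ℝ) * n i = g * d i := by exact_mod_cast hdg i
      linear_combination b * this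
    simp_rw [h2, mul_smul _ (d _ : ℝ), ← Finset.smul_sum, Int.cast_smul_eq_zsmul] at h1
    exact (smul_eq_zero.1 h1).resolve_left (mul_ne_zero hb.ne' hg')
  have hdcirc : ∀ a : t → ℝ, ∑ i, a i • P.coroot i = 0 → ∃ τ : ℝ, ∀ i, a i = τ * d i := by
    intro a ha
    obtain ⟨τ, hτ⟩ := hcirc (fun i ↦ a i / (b * n i)) (he (by
      rw [map_zero, ← ha]
      simp only [map_sum, map_smul, ← hBe', smul_smul]
      refine Finset.sum_congr rfl fun i _ ↦ ?_
      rw [div_mul_cancel₀ _ (mul_ne_zero hb.ne' (hn0 i))]))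
    refine ⟨τ * b * g, fun i ↦ ?_⟩
    have h1 := hτ i
    have h2 : (c i : ℝ) * n i = g * d i := by exact_mod_cast hdg i
    rw [div_eq_iff (mul_ne_zero hb.ne' (hn0 i))] at h1
    rw [h1]
    linear_combination τ * b * h2
  refine ⟨t, c, d, hts, hcrel, hdrel, ?_⟩
  obtain ⟨i, hi⟩ := exists_isUnit_of_circuit P (fun i : t ↦ (i : ι)) c w hcrel hcirc hw
  obtain ⟨j, hj⟩ := exists_isUnit_of_circuit P.flip (fun i : t ↦ (i : ι)) d v hdrel hdcirc hv
  have hgr : g ∣ r := by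
    have h1 (k : t) : g ∣ w k * c k * r := by
      have : g ∣ c k * n k := ⟨d k, hdg k⟩
      rcases hn k with h | h
      · rw [h, mul_one] at this
        exact (this.mul_left _).mul_right _
      · rw [h] at this
        rw [mul_assoc]
        exact this.mul_left _
    have := Finset.dvd_sum fun k (_ : k ∈ Finset.univ) ↦ h1 k
    rwa [← Finset.sum_mul, hw, one_mul] at this
  by_cases hgu : IsUnit g
  · refine ⟨j, ?_, hj⟩
    have := hgu.mul hj
    rw [← hdg j] at this
    exact isUnit_of_mul_isUnit_left this
  · have hrp : Prime r := by
      refine hr.resolve_left ?_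
      rintro rfl
      exact hgu (isUnit_of_dvd_one hgr)
    obtain ⟨u, hu⟩ := hgr
    have huu : IsUnit u := (hrp.irreducible.isUnit_or_isUnit hu).resolve_left hgu
    refine ⟨i, hi, ?_⟩
    have h1 : c i * n i = g * d i := hdg i
    rcases hn i with h | h
    · rw [h, mul_one] at h1
      rw [h1] at hi
      exact absurd (isUnit_of_mul_isUnit_left hi) hgu
    · rw [h, hu, mul_left_comm] at h1
      rw [← mul_left_cancel₀ hg h1]
      exact hi.mul huu

/-! ### Removal of superfluous roots, and cardinality of minimal sets. -/

lemma mem_span_image_diff_singleton {M : Type*} [AddCommGroup M] {v : ι → M} {s : Set ι}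
    {t : Finset ι} (hts : (t : Set ι) ⊆ s) {c : t → ℤ} (hc : ∑ i, c i • v i = 0) {i : t}
    (hi : IsUnit (c i)) : v i ∈ span ℤ (v '' (s \ {(i : ι)})) := by
  classical
  rw [← Finset.add_sum_erase _ _ (Finset.mem_univ i)] at hc
  have h1 : c i • v i ∈ span ℤ (v '' (s \ {(i : ι)})) := by
    rw [eq_neg_of_add_eq_zero_left hc]
    refine neg_mem (sum_mem fun j hj ↦ smul_mem _ _ (subset_span ⟨j, ⟨hts j.2, fun h ↦ ?_⟩, rfl⟩))
    exact (Finset.ne_of_mem_erase hj) (Subtype.ext h)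
  have h2 := smul_mem _ (c i) h1
  rwa [smul_smul, Int.isUnit_mul_self hi, one_smul] at h2

lemma span_image_le_span_image_diff_singleton {M : Type*} [AddCommGroup M] {v : ι → M} {s : Set ι}
    {i : ι} (hi : v i ∈ span ℤ (v '' (s \ {i}))) : span ℤ (v '' s) ≤ span ℤ (v '' (s \ {i})) := by
  rw [span_le]
  rintro _ ⟨j, hj, rfl⟩
  by_cases h : j = i
  · rw [h]
    exact hi
  · exact subset_span ⟨j, ⟨hj, h⟩, rfl⟩

lemma GeneratesLattices.exists_diff_singleton [Finite ι] {P : RootPairing ι ℝ V N}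
    [P.IsRootSystem] [P.IsCrystallographic] [P.IsReduced] [P.IsIrreducible] {s : Set ι}
    (h : GeneratesLattices P s) (hs : ¬ LinearIndepOn ℝ P.root s) :
    ∃ i ∈ s, GeneratesLattices P (s \ {i}) := by
  obtain ⟨t, c, d, hts, hc, hd, i, hci, hdi⟩ := exists_unit_relations P hs
  have h1 := mem_span_image_diff_singleton hts hc hci
  have h2 := mem_span_image_diff_singleton hts hd hdi
  exact ⟨i, hts i.2, fun j ↦ span_image_le_span_image_diff_singleton h1 (h.1 j),
    fun j ↦ span_image_le_span_image_diff_singleton h2 (h.2 j)⟩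

lemma GeneratesLattices.span_eq_top {P : RootPairing ι ℝ V N} [P.IsRootSystem] {s : Set ι}
    (h : GeneratesLattices P s) : span ℝ (P.root '' s) = ⊤ := by
  rw [eq_top_iff, ← RootPairing.IsRootSystem.span_root_eq_top (P := P), span_le]
  rintro _ ⟨i, rfl⟩
  exact span_subset_span ℤ ℝ _ (h.1 i)

lemma GeneratesLattices.finrank_le_encard [Finite ι] {P : RootPairing ι ℝ V N} [P.IsRootSystem]
    {s : Set ι} (h : GeneratesLattices P s) : (Module.finrank ℝ V : ℕ∞) ≤ s.encard := by
  classical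
  have hfin : (P.root '' s).Finite := (Set.toFinite s).image _
  have h1 := finrank_span_finset_le_card (R := ℝ) hfin.toFinset
  rw [Set.Finite.coe_toFinset, Set.finrank, h.span_eq_top, finrank_top] at h1
  calc (Module.finrank ℝ V : ℕ∞) ≤ hfin.toFinset.card := by exact_mod_cast h1
    _ = (P.root '' s).encard := hfin.encard_eq_coe_toFinset_card.symm
    _ ≤ s.encard := Set.encard_image_le _ _

lemma encard_eq_finrank [Finite ι] {P : RootPairing ι ℝ V N} [P.IsRootSystem] {s : Set ι}
    (h : GeneratesLattices P s) (hs : LinearIndepOn ℝ P.root s) :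
    s.encard = Module.finrank ℝ V := by
  have : Module.Finite ℝ V := ⟨by
    rw [← RootPairing.IsRootSystem.span_root_eq_top (P := P)]
    exact fg_span (Set.finite_range _)⟩
  refine le_antisymm (hs.encard_le_toENat_rank.trans ?_) h.finrank_le_encard
  rw [← Module.finrank_eq_rank]
  simp

lemma encard_eq_finrank_of_mem_sMinimalSets [Finite ι] {P : RootPairing ι ℝ V N}
    [P.IsRootSystem] [P.IsCrystallographic] [P.IsReduced] [P.IsIrreducible] {s : Set ι}
    (hs : s ∈ sMinimalSets P) : s.encard = Module.finrank ℝ V := by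
  have hg := (weylOf_eq_weyl_iff_generatesLattices P s).1 hs.1
  refine encard_eq_finrank hg ?_
  by_contra hdep
  obtain ⟨i, hi, h⟩ := hg.exists_diff_singleton hdep
  exact hs.2 _ (Set.sdiff_singleton_ssubset.2 hi)
    ((weylOf_eq_weyl_iff_generatesLattices P _).2 h)

lemma minReflections_eq_finrank [Finite ι] (P : RootPairing ι ℝ V N) [P.IsRootSystem]
    [P.IsCrystallographic] [P.IsReduced] [P.IsIrreducible] :
    minReflections P = Module.finrank ℝ V := by
  refine le_antisymm ?_ (le_sInf ?_)
  · obtain ⟨s, -, hs⟩ := exists_minimal_le_of_wellFoundedLT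
      (fun s : Set ι ↦ weylOf P s = weyl P) Set.univ (weylOf_univ P)
    have hmem : s ∈ sMinimalSets P := ⟨hs.prop, fun t ht h ↦ hs.not_prop_of_lt ht h⟩
    rw [← encard_eq_finrank_of_mem_sMinimalSets hmem]
    have h : minReflections P ≤ (P.reflection '' s).encard :=
      sInf_le ⟨P.reflection '' s, Set.image_subset_range _ _, hs.prop, rfl⟩
    exact h.trans (Set.encard_image_le _ _)
  · rintro _ ⟨T, hT, hgen, rfl⟩
    -- Opposite roots share a reflection, so one root is chosen for each element of `T`.
    obtain ⟨s, rfl, hinj⟩ := Set.exists_image_eq_injOn_of_subset_range hT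
    rw [hinj.encard_image]
    exact ((weylOf_eq_weyl_iff_generatesLattices P s).1 hgen).finrank_le_encard

end RootGen

theorem proposition2 {ι V N : Type*} [Finite ι]
    [AddCommGroup V] [Module ℝ V] [AddCommGroup N] [Module ℝ N]
    (P : RootPairing ι ℝ V N) [P.IsRootSystem] [P.IsCrystallographic] [P.IsReduced]
    [P.IsIrreducible] :
    RootGen.cMinimalSets P = RootGen.sMinimalSets P ∧
      RootGen.sMinimalSets P = RootGen.reflectableBases P := by
  constructor
  · ext s
    constructor
    · rintro ⟨hcard, hs⟩
      refine ⟨hs, fun t hts ht ↦ ?_⟩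
      -- A generating proper subset would also have at least `finrank ℝ V` elements, which is
      -- impossible since `s` is finite with exactly that many.
      have h1 := ((RootGen.weylOf_eq_weyl_iff_generatesLattices P t).1 ht).finrank_le_encard
      rw [← RootGen.minReflections_eq_finrank P, ← hcard] at h1
      exact ((Set.toFinite t).encard_lt_encard hts).not_ge h1
    · intro hs
      exact ⟨by rw [RootGen.encard_eq_finrank_of_mem_sMinimalSets hs,
        RootGen.minReflections_eq_finrank], hs.1⟩
  · ext s
    simp only [RootGen.sMinimalSets, RootGen.reflectableBases, Set.mem_ofPred_eq, ne_eq,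
      RootGen.weylOf_eq_weyl_iff_isReflectableSet]
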